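/- Let $d\in\mathbb N$ and let $g\in L^2(\mathbb R^d)$ be a window that is not almost everywhere zero and satisfies one of the following: (i) $g$ has exponential decay, i.e. $\int_{\mathbb R^d}|g(x)|^2e^{\sigma\|x\|_2}\,dx<\infty$ for some $\sigma>0$; or (ii) $d=1$ and $g$ is one-sided, i.e. $g=0$ a.e. on $(-\infty,0)$. For $f\in L^2(\mathbb R^d)$ let $$V_gf(z,\omega)=\int_{\mathbb R^d} f(y)\,\overline{e^{2\pi i\langle y,\omega\rangle}g(y-z)}\,dy\qquad(z,\omega\in\mathbb R^d)$$ be the short-time Fourier transform. Put $X=\{x\in\mathbb R^d : g(\cdot)\,\overline{g(\cdot-x)}\text{ is not a.e. zero}\}$, and let $C^*(f)$ be the set of all points $x\in\mathbb R^d$ at which $\{f\neq0\}$ has Lebesgue density one, i.e. $\lim_{\varepsilon\downarrow0}(2\varepsilon)^{-d}\lambda(\{y : f(y)\ne0,\ \|y-x\|_\infty<\varepsilon\})=1$, where $\lambda$ denotes Lebesgue measure. Two points $z,z'\in C^*(f)$ are called $X$-connected if there are $z_0,\dots,z_n\in C^*(f)$ with $z_0=z$, $z_n=z'$ and $z_{m+1}-z_m\in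 X$ for all $0\le m<n$; the equivalence classes $(C_m)_{m\in I}$ of this relation are the $X$-connectivity components of $f$, and $f$ is called $X$-connected if there is at most one component. We call $f$ phase retrievable with respect to $g$ if every $\tilde f\in L^2(\mathbb R^d)$ with $|V_gf|=|V_g\tilde f|$ satisfies $\tilde f=\gamma f$ a.e. for some $\gamma\in\mathbb C$ with $|\gamma|=1$. Then, for every $f\in L^2(\mathbb R^d)$: a) A signal $\tilde f\in L^2(\mathbb R^d)$ satisfies $|V_gf|=|V_g\tilde f|$ on $\mathbb R^d\times\mathbb R^d$ if and only if $C^*(\tilde f)=C^*(f)$ and for every $m\in I$ there is $\gamma_m\in\mathbb C$ with $|\gamma_m|=1$ such that $\tilde f=\gamma_mf$ almost everywhere on $C_m$. b) $f$ is phase retrievable with respect to $g$ if and only if $f$ is $X$-connected. -/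

import Mathlib

open MeasureTheory Filter Topology
open scoped ComplexConjugate

namespace STFTPhase

/-- The short-time Fourier transform of `f` with window `g` at the time-frequency point `(z, ω)`,
i.e. the inner product of `f` with `y ↦ exp (2 π i ⟨y, ω⟩) g (y - z)`
(the characters of `ℝ^d` are `y ↦ exp (2 π i ⟨y, ω⟩)`). -/
noncomputable def stft {d : ℕ} (g f : EuclideanSpace ℝ (Fin d) → ℂ)
    (z ω : EuclideanSpace ℝ (Fin d)) : ℂ :=
  ∫ y, f y * conj (Complex.exp (2 * Real.pi * Complex.I * (inner ℝ y ω : ℝ)) * g (y - z))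

/-- Equality of the phaseless measurements, `|V_g f| = |V_g h|`. -/
def SameMeasurement {d : ℕ} (g f h : EuclideanSpace ℝ (Fin d) → ℂ) : Prop :=
  ∀ z ω : EuclideanSpace ℝ (Fin d), ‖stft g f z ω‖ = ‖stft g h z ω‖

/-- `f` is determined by `|V_g f|` among all square-integrable functions, up to a global phase
(functions are identified when they agree almost everywhere). -/
def PhaseRetrievable {d : ℕ} (g f : EuclideanSpace ℝ (Fin d) → ℂ) : Prop :=
  ∀ h : EuclideanSpace ℝ (Fin d) → ℂ, MemLp h 2 volume → SameMeasurement g f h →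
    ∃ γ : ℂ, ‖γ‖ = 1 ∧ ∀ᵐ x, h x = γ * f x

/-- Square-integrable functions of exponential decay. -/
def ExpDecay {d : ℕ} (g : EuclideanSpace ℝ (Fin d) → ℂ) : Prop :=
  MemLp g 2 volume ∧
    ∃ σ : ℝ, 0 < σ ∧ Integrable (fun x => ‖g x‖ ^ 2 * Real.exp (σ * ‖x‖)) volume

/-- One-sided square-integrable functions, in dimension one only: `g` vanishes almost everywhere
on the negative half-line. -/
def OneSided {d : ℕ} (g : EuclideanSpace ℝ (Fin d) → ℂ) : Prop :=
  MemLp g 2 volume ∧ d = 1 ∧ ∀ᵐ x : EuclideanSpace ℝ (Fin d), ∀ i, x i < 0 → g x = 0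

/-- The set of admissible translations of the window `g`: all `x` for which the product of `g`
with the conjugate of its translate by `x` is not almost everywhere zero. -/
def admissible {d : ℕ} (g : EuclideanSpace ℝ (Fin d) → ℂ) : Set (EuclideanSpace ℝ (Fin d)) :=
  {x | ¬ ∀ᵐ t, g t * conj (g (t - x)) = 0}

/-- The open cube with centre `x` and side length `2 * ε` (the open sup-norm ball). -/
def cube {d : ℕ} (x : EuclideanSpace ℝ (Fin d)) (ε : ℝ) : Set (EuclideanSpace ℝ (Fin d)) :=
  {y | ∀ i, |y i - x i| < ε}

/-- The set of points at which `M` has Lebesgue density one. -/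
def densityPoints {d : ℕ} (M : Set (EuclideanSpace ℝ (Fin d))) :
    Set (EuclideanSpace ℝ (Fin d)) :=
  {x | Tendsto (fun ε : ℝ => (volume (M ∩ cube x ε)).toReal / (2 * ε) ^ d) (𝓝[>] 0) (𝓝 1)}

/-- The density-point support of `f`: the density points of the set where `f` is nonzero. -/
def densitySupport {d : ℕ} (f : EuclideanSpace ℝ (Fin d) → ℂ) :
    Set (EuclideanSpace ℝ (Fin d)) :=
  densityPoints {z | f z ≠ 0}

/-- `z` and `w` are points of `A` joined by a finite chain of points of `A` whose successive
differences belong to `X`; the chain of length zero is allowed. -/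
def Joined {d : ℕ} (X A : Set (EuclideanSpace ℝ (Fin d))) (z w : EuclideanSpace ℝ (Fin d)) :
    Prop :=
  z ∈ A ∧ w ∈ A ∧ Relation.ReflTransGen (fun u v => u ∈ A ∧ v ∈ A ∧ v - u ∈ X) z w

/-- The `X`-connectivity components of `A`: the classes of the relation `Joined X A`. -/
def components {d : ℕ} (X A : Set (EuclideanSpace ℝ (Fin d))) :
    Set (Set (EuclideanSpace ℝ (Fin d))) :=
  {C | ∃ z ∈ A, C = {w | Joined X A z w}}

/-- `f` is `X`-connected: its density-point support has at most one `X`-connectivity component. -/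
def SignalConnected {d : ℕ} (X : Set (EuclideanSpace ℝ (Fin d)))
    (f : EuclideanSpace ℝ (Fin d) → ℂ) : Prop :=
  (components X (densitySupport f)).Subsingleton

end STFTPhase

/-! For fixed `z` the function `V_g f(z, ·)` is the Fourier transform of the slice `y ↦ f y * conj
(g (y - z))`, so its squared modulus is the transform of the autocorrelation of that slice.
Regrouping four factors, this autocorrelation at `x` is the correlation at `z` of `autoProd f x`
with `autoProd g x` (`crossCorr_slice`). Equality of the measurements of `f` and `h` thus forces `𝓕
(autoProd f x) * conj (𝓕 (autoProd g x)) = 𝓕 (autoProd h x) * conj (𝓕 (autoProd g x))` for every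
`x`.

For `x` outside `X = admissible g` this is void. For `x` in `X` the decay or one-sidedness of `g`
makes `𝓕 (autoProd g x)` a boundary value or restriction of a holomorphic function, so it vanishes
on no ball, and continuity gives `autoProd f x = autoProd h x` a.e.
(`SameMeasurement.autoProd_ae_eq`). The converse is `sameMeasurement_of_autoProd`.

The rest is geometry. `X` is open, symmetric and contains `0`. The translation `0` gives `|f| =
|h|`, small translations give a locally constant phase (`exists_local_phase`), and two density
points with difference in `X` carry the same phase because their neighbourhoods overlap after
translation (`local_phase_eq`). Hence the phase is constant on components, and any choice of phases
on them is compatible with all products. For b), changing the sign of `f` off one component gives a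
counterexample as soon as there are two. -/

open scoped FourierTransform

namespace STFTPhase

/-! ### Fourier transforms, correlations and translation products -/

section Fourier

variable {E : Type*} [NormedAddCommGroup E] [InnerProductSpace ℝ E] [FiniteDimensional ℝ E]
  [MeasurableSpace E] [BorelSpace E]

/-- The Fourier transform is injective on integrable functions. -/
theorem ae_eq_zero_of_fourier_eq_zero {u : E → ℂ} (hu : Integrable u)
    (h : ∀ ω, 𝓕 u ω = 0) : ∀ᵐ x, u x = 0 := by
  refine ae_eq_zero_of_integral_contDiff_smul_eq_zero hu.locallyIntegrable fun φ hφ hφc => ?_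
  have hc : HasCompactSupport (fun x => (φ x : ℂ)) := hφc.comp_left Complex.ofReal_zero
  have hs : ContDiff ℝ (⊤ : ℕ∞) (fun x => (φ x : ℂ)) := Complex.ofRealCLM.contDiff.comp hφ
  -- Each test function is the transform of a Schwartz function `χ`, so the transform can be moved
  -- onto `u`, where it vanishes.
  set ψ : SchwartzMap E ℂ := hc.toSchwartzMap hs with hψ
  set χ : SchwartzMap E ℂ := 𝓕⁻ ψ with hχ
  have h1 : 𝓕 (χ : E → ℂ) = fun x => (φ x : ℂ) := by
    rw [← SchwartzMap.fourier_coe, hχ, FourierTransform.fourier_fourierInv_eq]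
    rfl
  have h2 := VectorFourier.integral_fourierIntegral_smul_eq_flip (L := innerₗ E)
    (μ := volume) (ν := volume) (e := Real.fourierChar) (f := (χ : E → ℂ)) (g := u)
    Real.continuous_fourierChar (by exact continuous_inner) χ.integrable hu
  have h3 : ∫ x, 𝓕 (χ : E → ℂ) x • u x = ∫ x, (χ : E → ℂ) x • 𝓕 u x := by
    simpa [flip_innerₗ] using! h2
  rw [h1] at h3
  simpa [h] using h3

theorem ae_eq_of_fourier_eq {u v : E → ℂ} (hu : Integrable u) (hv : Integrable v)
    (h : ∀ ω, 𝓕 u ω = 𝓕 v ω) : u =ᵐ[volume] v := by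
  have := ae_eq_zero_of_fourier_eq_zero (hu.sub hv) fun ω => by
    have : 𝓕 (u - v) ω = 𝓕 u ω - 𝓕 v ω := by
      simp only [Real.fourier_eq, Pi.sub_apply, smul_sub]
      exact integral_sub ((Real.fourierIntegral_convergent_iff ω).2 hu)
        ((Real.fourierIntegral_convergent_iff ω).2 hv)
    rw [this, h, sub_self]
  filter_upwards [this] with x hx
  exact sub_eq_zero.1 hx

theorem fourier_congr_ae {u v : E → ℂ} (h : u =ᵐ[volume] v) (ω : E) : 𝓕 u ω = 𝓕 v ω := by
  simp only [Real.fourier_eq]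
  exact integral_congr_ae (by filter_upwards [h] with x hx; rw [hx])

/-- The cross-correlation of two functions. -/
noncomputable def crossCorr (u v : E → ℂ) (x : E) : ℂ := ∫ y, u y * conj (v (y - x))

theorem crossCorr_eq_convolution (u v : E → ℂ) :
    crossCorr u v = convolution u (fun s => conj (v (-s))) (ContinuousLinearMap.mul ℂ ℂ) volume := by
  ext x
  simp [crossCorr, convolution]

theorem integrable_conj_neg {v : E → ℂ} (hv : Integrable v) :
    Integrable (fun s => conj (v (-s))) := by
  have : Integrable (fun s => v (-s)) := hv.comp_neg
  exact (Complex.conjLIE.toContinuousLinearEquiv.toContinuousLinearMap.integrable_comp this)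

theorem fourier_conj_neg (v : E → ℂ) (ω : E) :
    𝓕 (fun s => conj (v (-s))) ω = conj (𝓕 v ω) := by
  simp only [Real.fourier_eq]
  rw [← integral_conj, ← integral_neg_eq_self]
  refine integral_congr_ae (Eventually.of_forall fun y => ?_)
  simp [Circle.smul_def, ← Circle.coe_inv_eq_conj, AddChar.map_neg_eq_inv]

theorem integrable_crossCorr {u v : E → ℂ} (hu : Integrable u) (hv : Integrable v) :
    Integrable (crossCorr u v) := by
  rw [crossCorr_eq_convolution]
  exact hu.integrable_convolution _ (integrable_conj_neg hv)

theorem fourier_crossCorr {u v : E → ℂ} (hu : Integrable u) (hv : Integrable v) (ω : E) :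
    𝓕 (crossCorr u v) ω = 𝓕 u ω * conj (𝓕 v ω) := by
  rw [crossCorr_eq_convolution, Real.fourier_mul_convolution_eq hu (integrable_conj_neg hv),
    fourier_conj_neg]

theorem fourier_crossCorr_self {u : E → ℂ} (hu : Integrable u) (ω : E) :
    𝓕 (crossCorr u u) ω = ((‖𝓕 u ω‖ ^ 2 : ℝ) : ℂ) := by
  rw [fourier_crossCorr hu hu, Complex.mul_conj, Complex.normSq_eq_norm_sq]

/-- The correlation of a square-integrable function with the translates of another one depends
continuously on the translation. -/
theorem continuous_crossCorr {a b : E → ℂ} (ha : MemLp a 2 volume) (hb : MemLp b 2 volume) :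
    Continuous (crossCorr a b) := by
  have hfact : Fact ((2 : ENNReal) ≠ ⊤) := ⟨by simp⟩
  -- The correlation is an `L²` inner product with a translate, and translation acts continuously on
  -- `L²`.
  have hc : Continuous fun x : E => inner ℂ ((DomAddAct.mk (-x)) +ᵥ hb.toLp b) (ha.toLp a) := by
    have : Continuous fun x : E => (DomAddAct.mk (-x)) +ᵥ hb.toLp b :=
      (DomAddAct.continuous_mk.comp continuous_neg).vadd continuous_const
    exact this.inner continuous_const
  convert! hc using 1
  ext x
  rw [L2.inner_def, crossCorr]
  refine integral_congr_ae ?_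
  filter_upwards [ha.coeFn_toLp, DomAddAct.vadd_Lp_ae_eq (DomAddAct.mk (-x)) (hb.toLp b),
    (measurePreserving_add_left volume (-x)).quasiMeasurePreserving.ae hb.coeFn_toLp]
    with y h1 h2 h3
  rw [h1, h2]
  simp only [Equiv.symm_apply_apply, vadd_eq_add]
  rw [h3]
  simp [sub_eq_neg_add]

/-- The product of a function with the conjugate of its translate. -/
noncomputable def autoProd (f : E → ℂ) (x y : E) : ℂ := f y * conj (f (y - x))

theorem MemLp.integrable_mul_conj_translate {a b : E → ℂ} (ha : MemLp a 2 volume)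
    (hb : MemLp b 2 volume) (x : E) : Integrable (fun y => a y * conj (b (y - x))) := by
  have h1 : MemLp (fun y => b (y - x)) 2 volume :=
    hb.comp_measurePreserving (measurePreserving_sub_right volume x)
  exact ha.integrable_mul h1.star

theorem integrable_autoProd {f : E → ℂ} (hf : MemLp f 2 volume) (x : E) :
    Integrable (autoProd f x) :=
  MemLp.integrable_mul_conj_translate hf hf x

/-- The character can be absorbed into the first factor, which turns the value at `ω` into a
correlation of two square-integrable functions. -/
theorem continuous_fourier_autoProd {f : E → ℂ} (hf : MemLp f 2 volume) (ω : E) :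
    Continuous fun x => 𝓕 (autoProd f x) ω := by
  have h1 : MemLp (fun y => ((𝐞 (-inner ℝ y ω) : Circle) : ℂ) * f y) 2 volume := by
    refine hf.congr_norm (AEStronglyMeasurable.mul ?_ hf.1)
      (Eventually.of_forall fun a => by rw [norm_mul, Circle.norm_coe, one_mul])
    exact Continuous.aestronglyMeasurable (by fun_prop)
  convert! continuous_crossCorr h1 hf using 1
  ext x
  simp only [Real.fourier_eq, crossCorr, autoProd, Circle.smul_def, smul_eq_mul, mul_assoc]

theorem ae_translate {f f' : E → ℂ} (h : f =ᵐ[volume] f') (x : E) :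
    ∀ᵐ y, f (y - x) = f' (y - x) :=
  (measurePreserving_sub_right volume x).quasiMeasurePreserving.ae h

theorem autoProd_congr_ae {f f' : E → ℂ} (h : f =ᵐ[volume] f') (x : E) :
    autoProd f x =ᵐ[volume] autoProd f' x := by
  filter_upwards [h, ae_translate h x] with y h1 h2
  simp [autoProd, h1, h2]

/-- Joint measurability, needed to exchange "almost every `x`" and "almost every `z`". -/
theorem stronglyMeasurable_crossCorr_autoProd {f g : E → ℂ}
    (hf : StronglyMeasurable f) (hg : StronglyMeasurable g) :
    StronglyMeasurable fun p : E × E => crossCorr (autoProd f p.2) (autoProd g p.2) p.1 := by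
  have hc : Measurable (fun z : ℂ => conj z) := Complex.continuous_conj.measurable
  have m1 : Measurable fun p : (E × E) × E => p.2 := measurable_snd
  have m2 : Measurable fun p : (E × E) × E => p.2 - p.1.2 := by fun_prop
  have m3 : Measurable fun p : (E × E) × E => p.2 - p.1.1 := by fun_prop
  have m4 : Measurable fun p : (E × E) × E => p.2 - p.1.1 - p.1.2 := by fun_prop
  have m : Measurable fun p : (E × E) × E => f p.2 * conj (f (p.2 - p.1.2)) *
      conj (g (p.2 - p.1.1) * conj (g (p.2 - p.1.1 - p.1.2))) :=
    ((hf.measurable.comp m1).mul (hc.comp (hf.measurable.comp m2))).mul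
      (hc.comp ((hg.measurable.comp m3).mul (hc.comp (hg.measurable.comp m4))))
  exact m.stronglyMeasurable.integral_prod_right (f := fun (p : E × E) (y : E) =>
    f y * conj (f (y - p.2)) * conj (g (y - p.1) * conj (g (y - p.1 - p.2))))

end Fourier

/-! ### From phaseless measurements to translation products -/

variable {d : ℕ}

theorem stft_eq_fourier (g f : EuclideanSpace ℝ (Fin d) → ℂ) (z ω : EuclideanSpace ℝ (Fin d)) :
    stft g f z ω = 𝓕 (fun y => f y * conj (g (y - z))) ω := by
  simp only [stft, Real.fourier_eq, Circle.smul_def, smul_eq_mul, Real.fourierChar_apply]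
  refine integral_congr_ae (Eventually.of_forall fun y => ?_)
  simp only [map_mul, ← Complex.exp_conj]
  have : conj (2 * (Real.pi : ℂ) * Complex.I * ((inner ℝ y ω : ℝ) : ℂ))
      = ((2 * Real.pi * -inner ℝ y ω : ℝ) : ℂ) * Complex.I := by
    simp only [map_mul, Complex.conj_ofReal, Complex.conj_I, map_ofNat]
    push_cast
    ring
  rw [← this, map_mul, map_mul, map_mul]
  ring

theorem stft_congr_ae {g g' f f' : EuclideanSpace ℝ (Fin d) → ℂ} (hg : g =ᵐ[volume] g')
    (hf : f =ᵐ[volume] f') (z ω : EuclideanSpace ℝ (Fin d)) : stft g f z ω = stft g' f' z ω := by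
  rw [stft_eq_fourier, stft_eq_fourier]
  refine fourier_congr_ae ?_ ω
  filter_upwards [hf, ae_translate hg z] with y h1 h2
  rw [h1, h2]

/-- Both integrands are the same product of four factors: one pairing groups by the shift `z`, the
other by the shift `x`. -/
theorem crossCorr_slice (g f : EuclideanSpace ℝ (Fin d) → ℂ) (z x : EuclideanSpace ℝ (Fin d)) :
    crossCorr (fun y => f y * conj (g (y - z))) (fun y => f y * conj (g (y - z))) x =
      crossCorr (autoProd f x) (autoProd g x) z := by
  simp only [crossCorr, autoProd]
  refine integral_congr_ae (Eventually.of_forall fun y => ?_)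
  simp only [map_mul, Complex.conj_conj, sub_right_comm y x z]
  ring

/-- Phaseless measurements agree as soon as the products `autoProd` agree for all admissible
translations. -/
theorem sameMeasurement_of_autoProd {g f h : EuclideanSpace ℝ (Fin d) → ℂ}
    (hg : MemLp g 2 volume) (hf : MemLp f 2 volume) (hh : MemLp h 2 volume)
    (H : ∀ x ∈ admissible g, autoProd f x =ᵐ[volume] autoProd h x) : SameMeasurement g f h := by
  intro z ω
  have key : crossCorr (fun y => f y * conj (g (y - z))) (fun y => f y * conj (g (y - z))) =
      crossCorr (fun y => h y * conj (g (y - z))) (fun y => h y * conj (g (y - z))) := by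
    ext x
    rw [crossCorr_slice, crossCorr_slice, crossCorr, crossCorr]
    refine integral_congr_ae ?_
    by_cases hx : x ∈ admissible g
    · filter_upwards [H x hx] with y hy
      rw [hy]
    · have hx' : autoProd g x =ᵐ[volume] 0 := not_not.1 hx
      filter_upwards [ae_translate hx' z] with y hy
      rw [hy]
      simp
  have h1 := fourier_crossCorr_self (MemLp.integrable_mul_conj_translate hf hg z) ω
  have h2 := fourier_crossCorr_self (MemLp.integrable_mul_conj_translate hh hg z) ω
  rw [key, h2] at h1
  rw [stft_eq_fourier, stft_eq_fourier]
  have h3 := Complex.ofReal_injective h1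
  exact ((sq_eq_sq₀ (norm_nonneg _) (norm_nonneg _)).1 h3).symm

/-- Equal phaseless measurements of strongly measurable signals: the identity satisfied by the
Fourier transforms of the products `autoProd`. -/
theorem SameMeasurement.fourier_autoProd_of_stronglyMeasurable
    {g f h : EuclideanSpace ℝ (Fin d) → ℂ}
    (hg : MemLp g 2 volume) (hf : MemLp f 2 volume) (hh : MemLp h 2 volume)
    (mg : StronglyMeasurable g) (mf : StronglyMeasurable f) (mh : StronglyMeasurable h)
    (H : SameMeasurement g f h) (x ω : EuclideanSpace ℝ (Fin d)) :
    𝓕 (autoProd f x) ω * conj (𝓕 (autoProd g x) ω) =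
      𝓕 (autoProd h x) ω * conj (𝓕 (autoProd g x) ω) := by
  have h1 : ∀ z : EuclideanSpace ℝ (Fin d), ∀ᵐ x : EuclideanSpace ℝ (Fin d),
      crossCorr (autoProd f x) (autoProd g x) z = crossCorr (autoProd h x) (autoProd g x) z := by
    intro z
    have hF := MemLp.integrable_mul_conj_translate hf hg z
    have hH := MemLp.integrable_mul_conj_translate hh hg z
    have := ae_eq_of_fourier_eq (integrable_crossCorr hF hF) (integrable_crossCorr hH hH)
      fun ω => by
        rw [fourier_crossCorr_self hF, fourier_crossCorr_self hH, ← stft_eq_fourier,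
          ← stft_eq_fourier, H z ω]
    filter_upwards [this] with x hx
    rwa [crossCorr_slice, crossCorr_slice] at hx
  have h2 : ∀ᵐ x : EuclideanSpace ℝ (Fin d), ∀ᵐ z : EuclideanSpace ℝ (Fin d),
      crossCorr (autoProd f x) (autoProd g x) z = crossCorr (autoProd h x) (autoProd g x) z := by
    refine (Measure.ae_ae_comm ?_).1 (Eventually.of_forall h1)
    exact measurableSet_eq_fun (stronglyMeasurable_crossCorr_autoProd mf mg).measurable
      (stronglyMeasurable_crossCorr_autoProd mh mg).measurable
  have h3 : (fun x => 𝓕 (autoProd f x) ω * conj (𝓕 (autoProd g x) ω)) =ᵐ[volume]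
      fun x => 𝓕 (autoProd h x) ω * conj (𝓕 (autoProd g x) ω) := by
    filter_upwards [h2] with x hx
    rw [← fourier_crossCorr (integrable_autoProd hf x) (integrable_autoProd hg x),
      ← fourier_crossCorr (integrable_autoProd hh x) (integrable_autoProd hg x)]
    exact fourier_congr_ae hx ω
  -- Both sides are continuous in `x`, which removes the exceptional null set left by Fubini.
  have cg := continuous_fourier_autoProd hg ω
  have cf := continuous_fourier_autoProd hf ω
  have ch := continuous_fourier_autoProd hh ω
  exact congrFun ((Continuous.ae_eq_iff_eq volume
    (cf.mul (Complex.continuous_conj.comp cg)) (ch.mul (Complex.continuous_conj.comp cg))).1 h3) x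

/-- All quantities depend only on a.e. classes, so strongly measurable representatives may be used.
-/
theorem SameMeasurement.fourier_autoProd {g f h : EuclideanSpace ℝ (Fin d) → ℂ}
    (hg : MemLp g 2 volume) (hf : MemLp f 2 volume) (hh : MemLp h 2 volume)
    (H : SameMeasurement g f h) (x ω : EuclideanSpace ℝ (Fin d)) :
    𝓕 (autoProd f x) ω * conj (𝓕 (autoProd g x) ω) =
      𝓕 (autoProd h x) ω * conj (𝓕 (autoProd g x) ω) := by
  have eg := hg.1.ae_eq_mk
  have ef := hf.1.ae_eq_mk
  have eh := hh.1.ae_eq_mk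
  have := SameMeasurement.fourier_autoProd_of_stronglyMeasurable (hg.ae_eq eg) (hf.ae_eq ef)
    (hh.ae_eq eh) hg.1.stronglyMeasurable_mk hf.1.stronglyMeasurable_mk
    hh.1.stronglyMeasurable_mk
    (fun z ω => by rw [← stft_congr_ae eg ef, ← stft_congr_ae eg eh, H z ω]) x ω
  rwa [← fourier_congr_ae (autoProd_congr_ae eg x), ← fourier_congr_ae (autoProd_congr_ae ef x),
    ← fourier_congr_ae (autoProd_congr_ae eh x)] at this

/-! ### Holomorphic Laplace transforms and boundary uniqueness -/

section Holomorphic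

variable {α : Type*} [MeasurableSpace α] {μ : Measure α}

/-- Two-sided Laplace transforms are holomorphic on open sets of absolute convergence. -/
theorem differentiableOn_integral_mul_exp {H : α → ℂ} {s : α → ℝ} (hs : Measurable s) {U : Set ℂ}
    (hU : IsOpen U) (hint : ∀ ζ ∈ U, Integrable (fun y => H y * Complex.exp (ζ * s y)) μ) :
    DifferentiableOn ℂ (fun ζ => ∫ y, H y * Complex.exp (ζ * s y) ∂μ) U := by
  intro z hz
  obtain ⟨r, hr, hrU⟩ := Metric.isOpen_iff.1 hU z hz
  set ε := r / 4 with hε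
  have hε0 : 0 < ε := by positivity
  have hp : z + 2 * ε ∈ U := by
    apply hrU
    have : ‖(2 * ε : ℂ)‖ = 2 * ε := by
      rw [norm_mul, Complex.norm_real, Real.norm_of_nonneg hε0.le]; simp
    rw [Metric.mem_ball, dist_eq_norm, add_sub_cancel_left, this]
    linarith
  have hm : z - 2 * ε ∈ U := by
    apply hrU
    have : ‖(2 * ε : ℂ)‖ = 2 * ε := by
      rw [norm_mul, Complex.norm_real, Real.norm_of_nonneg hε0.le]; simp
    rw [Metric.mem_ball, dist_eq_norm, sub_sub_cancel_left, norm_neg, this]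
    linarith
  have hsc : Measurable fun y => (s y : ℂ) := Complex.measurable_ofReal.comp hs
  have hexp (ζ : ℂ) (y : α) : ‖Complex.exp (ζ * s y)‖ = Real.exp (ζ.re * s y) := by
    rw [Complex.norm_exp]; simp
  -- The factor `s` is absorbed by `|s| ≤ ε⁻¹ * exp (ε * |s|)`. Moving `ζ` within the `ε`-ball costs
  -- another `exp (ε * |s|)`, and the total is dominated by the integrands at `z ± 2 * ε`.
  have key := hasDerivAt_integral_of_dominated_loc_of_deriv_le (μ := μ) (𝕜 := ℂ)
    (F := fun ζ y => H y * Complex.exp (ζ * s y))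
    (F' := fun ζ y => H y * Complex.exp (ζ * s y) * s y) (x₀ := z) (s := Metric.ball z ε)
    (bound := fun y => ε⁻¹ * (‖H y * Complex.exp ((z + 2 * ε) * s y)‖ +
      ‖H y * Complex.exp ((z - 2 * ε) * s y)‖))
    (Metric.ball_mem_nhds z hε0)
    (by filter_upwards [hU.mem_nhds hz] with ζ hζ using (hint ζ hζ).1)
    (hint z hz) ((hint z hz).1.mul hsc.aestronglyMeasurable) ?_
    (((hint _ hp).norm.add (hint _ hm).norm).const_mul _) ?_
  · exact key.2.differentiableAt.differentiableWithinAt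
  · refine Eventually.of_forall fun y ζ hζ => ?_
    rw [norm_mul, norm_mul, norm_mul, norm_mul, hexp, hexp, hexp, Complex.norm_real, ← mul_add,
      mul_left_comm, mul_assoc]
    refine mul_le_mul_of_nonneg_left ?_ (norm_nonneg _)
    have h1 : |ζ.re - z.re| ≤ ε := by
      rw [← Complex.sub_re]
      exact (Complex.abs_re_le_norm _).trans (by rw [← dist_eq_norm]; exact hζ.le)
    have h2 : ζ.re * s y ≤ z.re * s y + ε * |s y| := by
      have : (ζ.re - z.re) * s y ≤ ε * |s y| := by
        refine (le_abs_self _).trans ?_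
        rw [abs_mul]
        exact mul_le_mul_of_nonneg_right h1 (abs_nonneg _)
      linarith
    have h3 : |s y| ≤ ε⁻¹ * Real.exp (ε * |s y|) := by
      rw [inv_mul_eq_div, le_div_iff₀ hε0]
      have := Real.add_one_le_exp (ε * |s y|)
      linarith
    have e1 : (z + 2 * ε).re = z.re + 2 * ε := by simp
    have e2 : (z - 2 * ε).re = z.re - 2 * ε := by simp
    calc Real.exp (ζ.re * s y) * ‖s y‖
        ≤ Real.exp (z.re * s y + ε * |s y|) * (ε⁻¹ * Real.exp (ε * |s y|)) := by
          gcongr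
          exact h3
      _ = ε⁻¹ * Real.exp (z.re * s y + 2 * ε * |s y|) := by
          rw [mul_left_comm, ← Real.exp_add]; ring_nf
      _ ≤ _ := by
          refine mul_le_mul_of_nonneg_left ?_ (inv_nonneg.2 hε0.le)
          rw [e1, e2]
          rcases abs_cases (s y) with ⟨h, -⟩ | ⟨h, -⟩ <;> rw [h]
          · have : z.re * s y + 2 * ε * s y = (z.re + 2 * ε) * s y := by ring
            rw [this]
            linarith [Real.exp_pos ((z.re - 2 * ε) * s y)]
          · have : z.re * s y + 2 * ε * -s y = (z.re - 2 * ε) * s y := by ring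
            rw [this]
            linarith [Real.exp_pos ((z.re + 2 * ε) * s y)]
  · refine Eventually.of_forall fun y ζ hζ => ?_
    have := (((hasDerivAt_id ζ).mul_const (s y : ℂ)).cexp).const_mul (H y)
    simpa [mul_assoc] using! this

/-- Boundary uniqueness: a function continuous on the closed left half-plane, holomorphic inside,
and vanishing on a segment of the boundary, is zero. -/
theorem eq_zero_of_eq_zero_on_boundary_segment {F : ℂ → ℂ} (hc : ContinuousOn F {z | z.re ≤ 0})
    (hd : DifferentiableOn ℂ F {z | z.re < 0}) {δ : ℝ} (hδ : 0 < δ)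
    (h0 : ∀ t : ℝ, |t| < δ → F (t * Complex.I) = 0) : ∀ z : ℂ, z.re ≤ 0 → F z = 0 := by
  have hF0 : ∀ z : ℂ, z.re = 0 → |z.im| < δ → F z = 0 := by
    intro z hz hzi
    have : z = z.im * Complex.I := by apply Complex.ext <;> simp [hz]
    rw [this]
    exact h0 _ hzi
  -- The square centred at `p` with half side `-p.re` touches the boundary line along a part of the
  -- segment. The product of `F` over the four quarter turns of this square vanishes on all its
  -- sides, hence at the centre by the maximum principle, where it equals `F p ^ 4`.
  have hloc : ∀ p : ℂ, p.re < 0 → |p.im| - p.re < δ → F p = 0 := by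
    intro p hp hpδ
    set b := -p.re with hb
    have hb0 : 0 < b := by linarith
    set Q : Set ℂ := {w | |w.re| < b ∧ |w.im| < b} with hQ
    have hQo : IsOpen Q := (isOpen_lt (by fun_prop) (by fun_prop)).and
      (isOpen_lt (by fun_prop) (by fun_prop))
    have hQc : closure Q ⊆ {w | |w.re| ≤ b ∧ |w.im| ≤ b} :=
      closure_minimal (fun w hw => ⟨hw.1.le, hw.2.le⟩)
        ((isClosed_le (by fun_prop) (by fun_prop)).and
          (isClosed_le (by fun_prop) (by fun_prop)))
    have hQb : Bornology.IsBounded Q := by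
      refine (Metric.isBounded_iff_subset_closedBall 0).2 ⟨b + b, fun w hw => ?_⟩
      rw [mem_closedBall_zero_iff]
      exact (Complex.norm_le_abs_re_add_abs_im w).trans (add_le_add hw.1.le hw.2.le)
    have hrot : ∀ c : ℂ, (∀ w : ℂ, |w.re| < b ∧ |w.im| < b → |(c * w).re| < b) →
        (∀ w : ℂ, |w.re| ≤ b ∧ |w.im| ≤ b → |(c * w).re| ≤ b) →
        DiffContOnCl ℂ (fun w => F (p + c * w)) Q := by
      intro c h1 h2
      constructor
      · refine hd.comp (by fun_prop) fun w hw => ?_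
        have := (abs_lt.1 (h1 w hw)).2
        simp only [Set.mem_ofPred_eq, Complex.add_re]
        linarith
      · refine hc.comp (by fun_prop) fun w hw => ?_
        have := (abs_le.1 (h2 w (hQc hw))).2
        simp only [Set.mem_ofPred_eq, Complex.add_re]
        linarith
    have d1 := hrot 1 (fun w hw => by simpa using hw.1) (fun w hw => by simpa using hw.1)
    have d2 := hrot Complex.I (fun w hw => by simpa using hw.2) (fun w hw => by simpa using hw.2)
    have d3 := hrot (-1) (fun w hw => by simpa using hw.1) (fun w hw => by simpa using hw.1)
    have d4 := hrot (-Complex.I) (fun w hw => by simpa using hw.2)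
      (fun w hw => by simpa using hw.2)
    have hD := ((d1.smul d2).smul d3).smul d4
    have hfr : ∀ w ∈ frontier Q, ‖((((fun w => F (p + 1 * w)) • (fun w => F (p + Complex.I * w))) •
        (fun w => F (p + (-1) * w))) • (fun w => F (p + (-Complex.I) * w))) w‖ ≤ 0 := by
      intro w hw
      have hwc := hQc hw.1
      have hwi : ¬ (|w.re| < b ∧ |w.im| < b) := by
        have := hw.2
        rwa [hQo.interior_eq] at this
      have him : ∀ t : ℝ, |t| ≤ b → |p.im + t| < δ := fun t ht => by
        have := abs_add_le p.im t
        linarith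
      have hcases : w.re = b ∨ w.re = -b ∨ w.im = b ∨ w.im = -b := by
        by_contra! hcon
        refine hwi ⟨lt_of_le_of_ne hwc.1 fun h => ?_, lt_of_le_of_ne hwc.2 fun h => ?_⟩
        · rcases (abs_eq hb0.le).1 h with h | h
          · exact hcon.1 h
          · exact hcon.2.1 h
        · rcases (abs_eq hb0.le).1 h with h | h
          · exact hcon.2.2.1 h
          · exact hcon.2.2.2 h
      have h2 := him _ hwc.1
      have h3 := him _ hwc.2
      have h4 := him (-w.re) (by rw [abs_neg]; exact hwc.1)
      have h5 := him (-w.im) (by rw [abs_neg]; exact hwc.2)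
      rw [norm_le_zero_iff]
      simp only [Pi.smul_apply', Pi.mul_apply, smul_eq_mul, mul_eq_zero]
      rcases hcases with h | h | h | h
      · exact Or.inl (Or.inl (Or.inl (hF0 _ (by simp [h, hb]) (by simpa using h3))))
      · exact Or.inl (Or.inr (hF0 _ (by simp [h, hb]) (by simpa using h5)))
      · exact Or.inr (hF0 _ (by simp [h, hb]) (by simpa using h4))
      · exact Or.inl (Or.inl (Or.inr (hF0 _ (by simp [h, hb]) (by simpa using h2))))
    have hz : (0 : ℂ) ∈ closure Q := subset_closure (by simp [hQ, hb0])
    have := Complex.norm_le_of_forall_mem_frontier_norm_le hQb hD hfr hz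
    by_contra hne
    have hpos := norm_pos_iff.2 hne
    have hle : ‖F p‖ * ‖F p‖ * ‖F p‖ * ‖F p‖ ≤ 0 := by simpa [Pi.smul_apply'] using this
    exact absurd hle (not_le.2 (by positivity))
  have han : AnalyticOnNhd ℂ F {z : ℂ | z.re < 0} :=
    hd.analyticOnNhd (isOpen_lt Complex.continuous_re continuous_const)
  have hpre : IsPreconnected {z : ℂ | z.re < 0} := (convex_halfSpace_re_lt 0).isPreconnected
  have hev : F =ᶠ[𝓝 ((-(δ / 2) : ℝ) : ℂ)] 0 := by
    have o : IsOpen {p : ℂ | p.re < 0 ∧ |p.im| - p.re < δ} :=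
      (isOpen_lt (by fun_prop) (by fun_prop)).and (isOpen_lt (by fun_prop) (by fun_prop))
    filter_upwards [o.mem_nhds (show ((-(δ / 2) : ℝ) : ℂ) ∈ _ by
      constructor
      · rw [Complex.ofReal_re]; linarith
      · rw [Complex.ofReal_re, Complex.ofReal_im, abs_zero]; linarith)] with p hp
    exact hloc p hp.1 hp.2
  -- The identity theorem spreads the local vanishing over the open half-plane, and continuity
  -- carries it to the boundary.
  have hzero := han.eqOn_zero_of_preconnected_of_eventuallyEq_zero hpre
    (show ((-(δ / 2) : ℝ) : ℂ) ∈ {z : ℂ | z.re < 0} by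
      rw [Set.mem_ofPred_eq, Complex.ofReal_re]; linarith) hev
  have hcl : {z : ℂ | z.re ≤ 0} ⊆ closure {z : ℂ | z.re < 0} := by
    rw [Complex.closure_setOfPred_re_lt]
  exact fun z hz => hzero.of_subset_closure hc continuousOn_const (fun w (hw : w.re < 0) => hw.le) hcl hz

end Holomorphic

/-! ### Fourier transforms that vanish on a ball -/

section Uniqueness

variable {E : Type*} [NormedAddCommGroup E] [InnerProductSpace ℝ E] [FiniteDimensional ℝ E]
  [MeasurableSpace E] [BorelSpace E]

/-- Along a line, the Fourier transform is a Laplace transform on the imaginary axis. -/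
theorem fourier_line (G : E → ℂ) (ω v : E) (t : ℝ) :
    ∫ y, ((𝐞 (-inner ℝ y ω) : Circle) : ℂ) * G y * Complex.exp ((t * Complex.I) * (inner ℝ y v : ℝ))
      = 𝓕 G (ω - (t / (2 * Real.pi)) • v) := by
  rw [Real.fourier_eq]
  refine integral_congr_ae (Eventually.of_forall fun y => ?_)
  simp only [Circle.smul_def, smul_eq_mul, Real.fourierChar_apply, inner_sub_right,
    inner_smul_right]
  rw [mul_right_comm, ← Complex.exp_add]
  congr 2
  push_cast
  field_simp
  ring

theorem continuous_fourier_of_integrable {G : E → ℂ} (hG : Integrable G) : Continuous (𝓕 G) :=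
  VectorFourier.fourierIntegral_continuous (L := innerₗ E) Real.continuous_fourierChar
    (by exact continuous_inner) hG

theorem integrable_char_mul {G : E → ℂ} (hG : Integrable G) (ω : E) :
    Integrable fun y => ((𝐞 (-inner ℝ y ω) : Circle) : ℂ) * G y := by
  simpa [Circle.smul_def] using (Real.fourierIntegral_convergent_iff ω).2 hG

theorem fourier_line_eq_zero_near (G : E → ℂ) (ω v : E) {r : ℝ} (hr : 0 < r)
    (h : ∀ w ∈ Metric.ball ω r, 𝓕 G w = 0) : ∃ δ > 0, ∀ t : ℝ, |t| < δ →
      𝓕 G (ω - (t / (2 * Real.pi)) • v) = 0 := by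
  have hc : Continuous fun t : ℝ => ω - (t / (2 * Real.pi)) • v := by fun_prop
  have : (fun t : ℝ => ω - (t / (2 * Real.pi)) • v) ⁻¹' Metric.ball ω r ∈ 𝓝 (0 : ℝ) :=
    hc.continuousAt (by simpa using Metric.ball_mem_nhds ω hr)
  obtain ⟨δ, hδ, hsub⟩ := Metric.mem_nhds_iff.1 this
  exact ⟨δ, hδ, fun t ht => h _ (hsub (by simpa using ht))⟩

/-- The Fourier transform of a function of exponential decay vanishes identically as soon as it
vanishes on a ball. -/
theorem fourier_eq_zero_of_expDecay {G : E → ℂ} (hG : Integrable G) {c : ℝ} (hc : 0 < c)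
    (hGc : Integrable fun y => ‖G y‖ * Real.exp (c * ‖y‖)) {ω₀ : E} {r : ℝ} (hr : 0 < r)
    (h : ∀ w ∈ Metric.ball ω₀ r, 𝓕 G w = 0) (ω : E) : 𝓕 G ω = 0 := by
  set v := ω₀ - ω with hv
  -- In the strip of half-width `a` the exponential grows at most like `exp (c * ‖y‖)`; the `+ 1`
  -- allows `v = 0`.
  set a := c / (‖v‖ + 1) with ha
  have hv1 : 0 < ‖v‖ + 1 := by positivity
  have ha0 : 0 < a := by positivity
  set H : E → ℂ := fun y => ((𝐞 (-inner ℝ y ω₀) : Circle) : ℂ) * G y with hH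
  have hHi : Integrable H := integrable_char_mul hG ω₀
  have hs : Measurable fun y : E => inner ℝ y v := by fun_prop
  set U : Set ℂ := {z | |z.re| < a} with hU
  have hUo : IsOpen U := isOpen_lt (by fun_prop) continuous_const
  have hUc : IsPreconnected U := by
    have : U = {z : ℂ | z.re < a} ∩ {z | -a < z.re} := by
      ext z; simp [hU, abs_lt, and_comm]
    rw [this]
    exact ((convex_halfSpace_re_lt a).inter (convex_halfSpace_re_gt (-a))).isPreconnected
  have hint : ∀ ζ ∈ U, Integrable fun y => H y * Complex.exp (ζ * (inner ℝ y v : ℝ)) := by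
    intro ζ hζ
    refine hGc.mono (hHi.1.mul (Measurable.aestronglyMeasurable (by fun_prop)))
      (Eventually.of_forall fun y => ?_)
    rw [norm_mul, hH, norm_mul, Circle.norm_coe, one_mul, Complex.norm_exp, norm_mul, norm_norm,
      Real.norm_of_nonneg (Real.exp_pos _).le]
    gcongr
    have e : (ζ * (inner ℝ y v : ℝ)).re = ζ.re * inner ℝ y v := by simp
    rw [e]
    calc ζ.re * inner ℝ y v ≤ |ζ.re| * |inner ℝ y v| := by
          rw [← abs_mul]; exact le_abs_self _
      _ ≤ a * (‖y‖ * ‖v‖) := by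
          gcongr
          · exact le_of_lt hζ
          · exact abs_real_inner_le_norm y v
      _ ≤ a * (‖y‖ * (‖v‖ + 1)) := by gcongr; linarith
      _ = c * ‖y‖ := by rw [ha]; field_simp
  have hdiff := (differentiableOn_integral_mul_exp hs hUo hint).analyticOnNhd hUo
  obtain ⟨δ, hδ, hzero⟩ := fourier_line_eq_zero_near G ω₀ v hr h
  have hfreq : ∃ᶠ z in 𝓝[≠] (0 : ℂ), ∫ y, H y * Complex.exp (z * (inner ℝ y v : ℝ)) = 0 := by
    have ht : Tendsto (fun t : ℝ => (t : ℂ) * Complex.I) (𝓝[≠] 0) (𝓝[≠] 0) := by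
      refine tendsto_nhdsWithin_iff.2 ⟨?_, ?_⟩
      · have : Continuous fun t : ℝ => (t : ℂ) * Complex.I := by fun_prop
        simpa using (this.tendsto 0).mono_left nhdsWithin_le_nhds
      · filter_upwards [self_mem_nhdsWithin] with t ht
        simpa using ht
    refine ht.frequently (Eventually.frequently ?_)
    filter_upwards [mem_nhdsWithin_of_mem_nhds (Metric.ball_mem_nhds (0 : ℝ) hδ)] with t ht
    rw [fourier_line]
    exact hzero t (by simpa using ht)
  -- The parameter `t = 2π` on the line corresponds to the frequency `ω₀ - v = ω`.
  have := hdiff.eqOn_zero_of_preconnected_of_frequently_eq_zero hUc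
    (show (0 : ℂ) ∈ U by simp [hU, ha0]) hfreq
    (show ((2 * Real.pi : ℝ) : ℂ) * Complex.I ∈ U by simp [hU, ha0])
  simp only [Pi.zero_apply] at this
  rw [fourier_line, div_self (by positivity), one_smul, hv, sub_sub_cancel] at this
  exact this

/-- The Fourier transform of a function supported in a half-space, if it vanishes on a ball, vanishes
on the line through the centre of the ball that is orthogonal to the half-space. -/
theorem fourier_eq_zero_of_halfSpace {G : E → ℂ} (hG : Integrable G) {v : E}
    (hGv : ∀ᵐ y, inner ℝ y v < 0 → G y = 0) {ω₀ : E} {r : ℝ} (hr : 0 < r)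
    (h : ∀ w ∈ Metric.ball ω₀ r, 𝓕 G w = 0) (t : ℝ) :
    𝓕 G (ω₀ - (t / (2 * Real.pi)) • v) = 0 := by
  set H : E → ℂ := fun y => ((𝐞 (-inner ℝ y ω₀) : Circle) : ℂ) * G y with hH
  have hHi : Integrable H := integrable_char_mul hG ω₀
  have hs : Measurable fun y : E => inner ℝ y v := by fun_prop
  have hmeas : ∀ ζ : ℂ,
      AEStronglyMeasurable (fun y => H y * Complex.exp (ζ * (inner ℝ y v : ℝ))) volume :=
    fun ζ => hHi.1.mul (Measurable.aestronglyMeasurable (by fun_prop))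
  have hbound : ∀ ζ : ℂ, ζ.re ≤ 0 →
      ∀ᵐ y, ‖H y * Complex.exp (ζ * (inner ℝ y v : ℝ))‖ ≤ ‖H y‖ := by
    intro ζ hζ
    filter_upwards [hGv] with y hy
    by_cases hyv : inner ℝ y v < 0
    · simp [hH, hy hyv]
    · rw [norm_mul, Complex.norm_exp]
      refine mul_le_of_le_one_right (norm_nonneg _) (Real.exp_le_one_iff.2 ?_)
      have e : (ζ * (inner ℝ y v : ℝ)).re = ζ.re * inner ℝ y v := by simp
      rw [e]
      exact mul_nonpos_of_nonpos_of_nonneg hζ (not_lt.1 hyv)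
  have hcont : ContinuousOn (fun ζ : ℂ => ∫ y, H y * Complex.exp (ζ * (inner ℝ y v : ℝ)))
      {z | z.re ≤ 0} := by
    refine continuousOn_of_dominated (fun ζ _ => hmeas ζ) hbound hHi.norm
      (Eventually.of_forall fun y => ?_)
    fun_prop
  have hdiff : DifferentiableOn ℂ (fun ζ : ℂ => ∫ y, H y * Complex.exp (ζ * (inner ℝ y v : ℝ)))
      {z | z.re < 0} :=
    differentiableOn_integral_mul_exp hs (isOpen_lt Complex.continuous_re continuous_const)
      fun ζ hζ => hHi.mono (hmeas ζ) (hbound ζ (le_of_lt hζ))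
  obtain ⟨δ, hδ, hzero⟩ := fourier_line_eq_zero_near G ω₀ v hr h
  have := eq_zero_of_eq_zero_on_boundary_segment hcont hdiff hδ
    (fun t ht => by rw [fourier_line]; exact hzero t ht) (t * Complex.I) (by simp)
  rwa [fourier_line] at this

end Uniqueness

/-! ### Nonvanishing for the two classes of windows -/

theorem ExpDecay.fourier_autoProd_eq_zero {g : EuclideanSpace ℝ (Fin d) → ℂ} (hg : ExpDecay g)
    (x : EuclideanSpace ℝ (Fin d)) {ω₀ : EuclideanSpace ℝ (Fin d)} {r : ℝ} (hr : 0 < r)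
    (h : ∀ w ∈ Metric.ball ω₀ r, 𝓕 (autoProd g x) w = 0) (ω : EuclideanSpace ℝ (Fin d)) :
    𝓕 (autoProd g x) ω = 0 := by
  obtain ⟨hg2, σ, hσ, hint⟩ := hg
  -- Half the rate: `‖g‖ * exp (σ / 2 * ‖y‖)` is square-integrable, and its product with a translate
  -- of `g` is integrable.
  refine fourier_eq_zero_of_expDecay (integrable_autoProd hg2 x) (half_pos hσ) ?_ hr h ω
  have hm : AEStronglyMeasurable (fun y => g y * ((Real.exp (σ / 2 * ‖y‖) : ℝ) : ℂ)) volume :=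
    hg2.1.mul (Continuous.aestronglyMeasurable (by fun_prop))
  have hnorm : ∀ y : EuclideanSpace ℝ (Fin d), ‖g y * ((Real.exp (σ / 2 * ‖y‖) : ℝ) : ℂ)‖ =
      ‖g y‖ * Real.exp (σ / 2 * ‖y‖) := fun y => by
    rw [norm_mul, Complex.norm_real, Real.norm_of_nonneg (Real.exp_pos _).le]
  have h2 : MemLp (fun y => g y * ((Real.exp (σ / 2 * ‖y‖) : ℝ) : ℂ)) 2 volume := by
    refine (memLp_two_iff_integrable_sq_norm hm).2 (hint.congr (Eventually.of_forall fun y => ?_))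
    simp only [hnorm]
    rw [mul_pow, ← Real.exp_nat_mul]
    congr 2
    push_cast
    ring
  refine (MemLp.integrable_mul_conj_translate h2 hg2 x).norm.congr
    (Eventually.of_forall fun y => ?_)
  simp only [autoProd]
  rw [norm_mul, hnorm, norm_mul]
  ring

theorem OneSided.fourier_autoProd_eq_zero {g : EuclideanSpace ℝ (Fin d) → ℂ} (hg : OneSided g)
    (x : EuclideanSpace ℝ (Fin d)) {ω₀ : EuclideanSpace ℝ (Fin d)} {r : ℝ} (hr : 0 < r)
    (h : ∀ w ∈ Metric.ball ω₀ r, 𝓕 (autoProd g x) w = 0) (ω : EuclideanSpace ℝ (Fin d)) :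
    𝓕 (autoProd g x) ω = 0 := by
  obtain ⟨hg2, rfl, hneg⟩ := hg
  -- The first factor alone gives half-line support, whatever `x` is. In dimension one the line
  -- through `ω₀` is the whole space, and the last argument is the parameter that reaches `ω`.
  have key := fourier_eq_zero_of_halfSpace (integrable_autoProd hg2 x)
    (v := EuclideanSpace.single 0 (1 : ℝ)) (by
      filter_upwards [hneg] with y hy hlt
      have : y 0 < 0 := by simpa [EuclideanSpace.inner_single_right] using hlt
      simp [autoProd, hy 0 this]) hr h ((ω₀ 0 - ω 0) * (2 * Real.pi))
  rw [mul_div_cancel_right₀ _ (by positivity)] at key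
  convert key using 2
  ext i
  fin_cases i
  simp

/-- The Fourier transform of a product `autoProd g x` that is not almost everywhere zero does not
vanish on any ball. -/
theorem exists_fourier_autoProd_ne_zero {g : EuclideanSpace ℝ (Fin d) → ℂ}
    (hg : ExpDecay g ∨ OneSided g) {x : EuclideanSpace ℝ (Fin d)} (hx : x ∈ admissible g)
    (ω₀ : EuclideanSpace ℝ (Fin d)) {r : ℝ} (hr : 0 < r) :
    ∃ w ∈ Metric.ball ω₀ r, 𝓕 (autoProd g x) w ≠ 0 := by
  by_contra! hcon
  have hg2 : MemLp g 2 volume := hg.elim (fun h => h.1) (fun h => h.1)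
  refine hx (ae_eq_zero_of_fourier_eq_zero (integrable_autoProd hg2 x) fun ω => ?_)
  rcases hg with hg | hg
  · exact hg.fourier_autoProd_eq_zero x hr hcon ω
  · exact hg.fourier_autoProd_eq_zero x hr hcon ω

/-- If the two transforms differed anywhere they would differ on a ball, and the window factor would
have to vanish there. -/
theorem SameMeasurement.autoProd_ae_eq {g f h : EuclideanSpace ℝ (Fin d) → ℂ}
    (hg : ExpDecay g ∨ OneSided g) (hf : MemLp f 2 volume) (hh : MemLp h 2 volume)
    (H : SameMeasurement g f h) {x : EuclideanSpace ℝ (Fin d)} (hx : x ∈ admissible g) :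
    autoProd f x =ᵐ[volume] autoProd h x := by
  have hg2 : MemLp g 2 volume := hg.elim (fun h => h.1) (fun h => h.1)
  have hfi := integrable_autoProd hf x
  have hhi := integrable_autoProd hh x
  refine ae_eq_of_fourier_eq hfi hhi fun ω => ?_
  by_contra hne
  have hopen : IsOpen {w | 𝓕 (autoProd f x) w ≠ 𝓕 (autoProd h x) w} :=
    isOpen_ne_fun (continuous_fourier_of_integrable hfi) (continuous_fourier_of_integrable hhi)
  obtain ⟨r, hr, hsub⟩ := Metric.isOpen_iff.1 hopen ω hne
  obtain ⟨w, hw, hgw⟩ := exists_fourier_autoProd_ne_zero hg hx ω hr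
  exact hsub hw (mul_right_cancel₀ (by simpa using hgw)
    (SameMeasurement.fourier_autoProd hg2 hf hh H x w))

/-! ### Lebesgue density with respect to cubes -/

section Density

theorem cube_eq_preimage (x : EuclideanSpace ℝ (Fin d)) {ε : ℝ} (hε : 0 < ε) :
    cube x ε = WithLp.ofLp ⁻¹' Metric.ball (WithLp.ofLp x) ε := by
  ext y
  simp [cube, dist_pi_lt_iff hε, Real.dist_eq]

theorem measurableSet_cube (x : EuclideanSpace ℝ (Fin d)) {ε : ℝ} (hε : 0 < ε) :
    MeasurableSet (cube x ε) := by
  rw [cube_eq_preimage x hε]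
  exact (PiLp.volume_preserving_ofLp (Fin d)).measurable measurableSet_ball

theorem volume_cube (x : EuclideanSpace ℝ (Fin d)) {ε : ℝ} (hε : 0 < ε) :
    volume (cube x ε) = ENNReal.ofReal ((2 * ε) ^ d) := by
  rw [cube_eq_preimage x hε, (PiLp.volume_preserving_ofLp (Fin d)).measure_preimage
    measurableSet_ball.nullMeasurableSet, Real.volume_pi_ball _ hε, Fintype.card_fin]

theorem densityPoints_congr {M N : Set (EuclideanSpace ℝ (Fin d))} (h : M =ᵐ[volume] N) :
    densityPoints M = densityPoints N := by
  ext x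
  have : ∀ ε : ℝ, volume (M ∩ cube x ε) = volume (N ∩ cube x ε) := fun ε =>
    measure_congr (h.inter (ae_eq_refl _))
  simp only [densityPoints, Set.mem_ofPred_eq, this]

theorem ae_mem_densityPoints_iff_of_measurableSet {M : Set (EuclideanSpace ℝ (Fin d))}
    (hM : MeasurableSet M) : ∀ᵐ x, x ∈ densityPoints M ↔ x ∈ M := by
  -- In the sup-norm model the cubes are balls, so the Besicovitch density theorem applies; open and
  -- closed balls differ by a null set.
  set S : Set (Fin d → ℝ) := WithLp.toLp 2 ⁻¹' M with hS
  have hSm : MeasurableSet S := (PiLp.volume_preserving_toLp (Fin d)).measurable hM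
  have h := (PiLp.volume_preserving_ofLp (Fin d)).quasiMeasurePreserving.ae
    (Besicovitch.ae_tendsto_measure_inter_div_of_measurableSet
      (volume : Measure (Fin d → ℝ)) hSm)
  filter_upwards [h] with x hx
  have hlim : Tendsto (fun ε : ℝ => (volume (M ∩ cube x ε)).toReal / (2 * ε) ^ d) (𝓝[>] 0)
      (𝓝 ((S.indicator 1 (WithLp.ofLp x) : ENNReal).toReal)) := by
    have h1 := (ENNReal.tendsto_toReal (a := (S.indicator 1 (WithLp.ofLp x) : ENNReal)) (by
      by_cases hxS : WithLp.ofLp x ∈ S <;> simp [hxS])).comp hx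
    refine h1.congr' ?_
    filter_upwards [self_mem_nhdsWithin] with ε hε
    have hε' : 0 < ε := hε
    have hball : (Metric.ball (WithLp.ofLp x) ε : Set (Fin d → ℝ)) =ᵐ[volume]
        Metric.closedBall (WithLp.ofLp x) ε :=
      ae_eq_of_subset_of_measure_ge Metric.ball_subset_closedBall
        (by rw [Real.volume_pi_ball _ hε', Real.volume_pi_closedBall _ hε'.le])
        measurableSet_ball.nullMeasurableSet measure_closedBall_lt_top.ne
    have e1 : volume (S ∩ Metric.closedBall (WithLp.ofLp x) ε) = volume (M ∩ cube x ε) := by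
      rw [← measure_congr ((ae_eq_refl S).inter hball),
        ← (PiLp.volume_preserving_ofLp (Fin d)).measure_preimage
          (hSm.inter measurableSet_ball).nullMeasurableSet, Set.preimage_inter,
        ← cube_eq_preimage x hε']
      rfl
    simp only [Function.comp_apply]
    rw [e1, Real.volume_pi_closedBall _ hε'.le, ENNReal.toReal_div, Fintype.card_fin,
      ENNReal.toReal_ofReal (by positivity)]
  constructor
  · intro hxd
    have := tendsto_nhds_unique hlim hxd
    by_contra hxM
    have hxS : WithLp.ofLp x ∉ S := hxM
    simp [hxS] at this
  · intro hxM
    have hxS : WithLp.ofLp x ∈ S := hxM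
    simpa [hxS] using! hlim

/-- Lebesgue's density theorem for cubes. -/
theorem ae_mem_densityPoints_iff {M : Set (EuclideanSpace ℝ (Fin d))}
    (hM : NullMeasurableSet M volume) : ∀ᵐ x, x ∈ densityPoints M ↔ x ∈ M := by
  obtain ⟨N, hN, hMN⟩ := hM
  rw [densityPoints_congr hMN]
  filter_upwards [ae_mem_densityPoints_iff_of_measurableSet hN, hMN.mem_iff] with x h1 h2
  rw [h1, h2]

theorem exists_cube_subset {x : EuclideanSpace ℝ (Fin d)} {U : Set (EuclideanSpace ℝ (Fin d))}
    (hU : U ∈ 𝓝 x) : ∃ r > 0, ∀ ε, 0 < ε → ε ≤ r → cube x ε ⊆ U := by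
  have hc : Continuous (WithLp.toLp 2 : (Fin d → ℝ) → EuclideanSpace ℝ (Fin d)) :=
    PiLp.continuous_toLp 2 _
  have : WithLp.toLp 2 ⁻¹' U ∈ 𝓝 (WithLp.ofLp x) := hc.continuousAt hU
  obtain ⟨r, hr, hsub⟩ := Metric.mem_nhds_iff.1 this
  refine ⟨r, hr, fun ε hε hεr y hy => ?_⟩
  rw [cube_eq_preimage x hε] at hy
  exact hsub (Metric.ball_subset_ball hεr hy)

/-- More than half is what forces two such sets in one cube to overlap. -/
theorem eventually_half_lt_volume_inter_cube {M : Set (EuclideanSpace ℝ (Fin d))}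
    {x : EuclideanSpace ℝ (Fin d)} (hx : x ∈ densityPoints M) :
    ∀ᶠ ε : ℝ in 𝓝[>] 0, ENNReal.ofReal ((2 * ε) ^ d / 2) < volume (M ∩ cube x ε) := by
  have h1 : ∀ᶠ ε : ℝ in 𝓝[>] 0, 1 / 2 < (volume (M ∩ cube x ε)).toReal / (2 * ε) ^ d :=
    Tendsto.eventually_const_lt (by norm_num) hx
  filter_upwards [h1, self_mem_nhdsWithin] with ε h hε
  have hε' : 0 < ε := hε
  have hpos : 0 < (2 * ε) ^ d := by positivity
  rw [lt_div_iff₀ hpos] at h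
  have hfin : volume (M ∩ cube x ε) ≠ ⊤ :=
    ne_top_of_le_ne_top (by rw [volume_cube x hε']; exact ENNReal.ofReal_ne_top)
      (measure_mono Set.inter_subset_right)
  rw [ENNReal.ofReal_lt_iff_lt_toReal (by positivity) hfin]
  linarith

/-- Near two density points of a set, the set and its translate overlap substantially. -/
theorem not_ae_not_mem_inter_translate {M : Set (EuclideanSpace ℝ (Fin d))}
    (hM : NullMeasurableSet M volume) {z w : EuclideanSpace ℝ (Fin d)}
    (hz : z ∈ densityPoints M) (hw : w ∈ densityPoints M) {U : Set (EuclideanSpace ℝ (Fin d))}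
    (hU : U ∈ 𝓝 w) : ¬ ∀ᵐ y, ¬ (y ∈ U ∧ y ∈ M ∧ y - (w - z) ∈ M) := by
  intro hnull
  obtain ⟨r, hr, hsub⟩ := exists_cube_subset hU
  obtain ⟨ε, ⟨h1, h2⟩, hε, hεr⟩ := ((eventually_half_lt_volume_inter_cube hz).and
    (eventually_half_lt_volume_inter_cube hw)).and (Ioc_mem_nhdsGT hr) |>.exists
  have mp := measurePreserving_sub_right (volume : Measure (EuclideanSpace ℝ (Fin d))) (w - z)
  have hA : NullMeasurableSet (M ∩ cube z ε) volume :=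
    hM.inter (measurableSet_cube z hε).nullMeasurableSet
  -- The part of `M` near `z`, moved into the cube at `w`: it and the part of `M` near `w` each fill
  -- more than half of that cube.
  set B : Set (EuclideanSpace ℝ (Fin d)) := (fun y => y - (w - z)) ⁻¹' (M ∩ cube z ε) with hB
  have hBm : NullMeasurableSet B volume := hA.preimage mp.quasiMeasurePreserving
  have hBv : volume B = volume (M ∩ cube z ε) := mp.measure_preimage hA
  have hBc : B ⊆ cube w ε := by
    intro y hy i
    have := hy.2 i
    simp only [PiLp.sub_apply] at this
    rwa [show y i - (w i - z i) - z i = y i - w i by ring] at this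
  have hdisj : AEDisjoint volume (M ∩ cube w ε) B := by
    refine measure_mono_null (fun y hy => ?_) (ae_iff.1 hnull)
    exact not_not.2 ⟨hsub ε hε hεr hy.1.2, hy.1.1, hy.2.1⟩
  have hle : volume (M ∩ cube w ε) + volume B ≤ volume (cube w ε) := by
    rw [← measure_union₀ hBm hdisj]
    exact measure_mono (Set.union_subset Set.inter_subset_right hBc)
  rw [hBv, volume_cube w hε] at hle
  refine absurd hle (not_le.2 ?_)
  calc ENNReal.ofReal ((2 * ε) ^ d)
      = ENNReal.ofReal ((2 * ε) ^ d / 2) + ENNReal.ofReal ((2 * ε) ^ d / 2) := by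
        rw [← ENNReal.ofReal_add (by positivity) (by positivity), add_halves]
    _ < _ := ENNReal.add_lt_add h2 h1

theorem not_ae_not_mem_of_mem_densityPoints {M : Set (EuclideanSpace ℝ (Fin d))}
    (hM : NullMeasurableSet M volume) {z : EuclideanSpace ℝ (Fin d)}
    (hz : z ∈ densityPoints M) {U : Set (EuclideanSpace ℝ (Fin d))}
    (hU : U ∈ 𝓝 z) : ¬ ∀ᵐ y, ¬ (y ∈ U ∧ y ∈ M) := fun h =>
  not_ae_not_mem_inter_translate hM hz hz hU (h.mono fun _ hy hy' => hy ⟨hy'.1, hy'.2.1⟩)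

theorem nullMeasurableSet_ne_zero {f : EuclideanSpace ℝ (Fin d) → ℂ}
    (hf : AEStronglyMeasurable f volume) : NullMeasurableSet {z | f z ≠ 0} volume :=
  hf.aemeasurable.nullMeasurable (measurableSet_singleton (0 : ℂ)).compl

theorem ae_mem_densitySupport_iff {f : EuclideanSpace ℝ (Fin d) → ℂ}
    (hf : AEStronglyMeasurable f volume) : ∀ᵐ x, x ∈ densitySupport f ↔ f x ≠ 0 :=
  ae_mem_densityPoints_iff (nullMeasurableSet_ne_zero hf)

theorem densitySupport_congr {f h : EuclideanSpace ℝ (Fin d) → ℂ}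
    (H : ∀ᵐ x, h x = 0 ↔ f x = 0) : densitySupport h = densitySupport f :=
  densityPoints_congr (by
    filter_upwards [H] with x hx
    exact propext (not_congr hx))

theorem ae_eq_zero_iff_of_densitySupport_eq {f h : EuclideanSpace ℝ (Fin d) → ℂ}
    (hf : AEStronglyMeasurable f volume) (hh : AEStronglyMeasurable h volume)
    (H : densitySupport h = densitySupport f) : ∀ᵐ x, h x = 0 ↔ f x = 0 := by
  filter_upwards [ae_mem_densitySupport_iff hf, ae_mem_densitySupport_iff hh] with x h1 h2
  rw [H, h1] at h2
  exact (not_iff_not.1 h2).symm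

end Density

/-! ### The set of admissible translations -/

section Admissible

variable {g : EuclideanSpace ℝ (Fin d) → ℂ}

/-- By injectivity of the Fourier transform, admissibility means that some `𝓕 (autoProd g x) ω` is
nonzero, and each of these is continuous in `x`. -/
theorem isOpen_admissible (hg : MemLp g 2 volume) : IsOpen (admissible g) := by
  have : admissible g = ⋃ ω, {x | 𝓕 (autoProd g x) ω ≠ 0} := by
    ext x
    rw [Set.mem_iUnion]
    constructor
    · intro hx
      by_contra! hcon
      exact hx (ae_eq_zero_of_fourier_eq_zero (integrable_autoProd hg x)
        fun ω => not_not.1 (hcon ω))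
    · rintro ⟨ω, hω⟩ hx
      have h0 : autoProd g x =ᵐ[volume] fun _ => 0 := hx
      exact hω (by rw [fourier_congr_ae h0, Real.fourier_eq]; simp)
  rw [this]
  exact isOpen_iUnion fun ω => isOpen_ne_fun (continuous_fourier_autoProd hg ω) continuous_const

theorem zero_mem_admissible (hg : ¬ ∀ᵐ x, g x = 0) : 0 ∈ admissible g := by
  intro h
  refine hg (h.mono fun t ht => ?_)
  simpa using ht

theorem neg_mem_admissible {x : EuclideanSpace ℝ (Fin d)} (hx : x ∈ admissible g) :
    -x ∈ admissible g := by
  intro h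
  refine hx ?_
  filter_upwards [(measurePreserving_sub_right volume x).quasiMeasurePreserving.ae h] with t ht
  rw [sub_neg_eq_add, sub_add_cancel] at ht
  have := congrArg conj ht
  rwa [map_mul, Complex.conj_conj, map_zero, mul_comm] at this

end Admissible

/-! ### Connectivity components -/

section Components

variable {X A : Set (EuclideanSpace ℝ (Fin d))}

theorem Joined.refl {z : EuclideanSpace ℝ (Fin d)} (hz : z ∈ A) : Joined X A z z :=
  ⟨hz, hz, Relation.ReflTransGen.refl⟩

theorem Joined.trans {u v w : EuclideanSpace ℝ (Fin d)} (h : Joined X A u v)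
    (h' : Joined X A v w) : Joined X A u w :=
  ⟨h.1, h'.2.1, h.2.2.trans h'.2.2⟩

theorem Joined.symm (hX : ∀ x ∈ X, -x ∈ X) {u v : EuclideanSpace ℝ (Fin d)}
    (h : Joined X A u v) : Joined X A v u := by
  refine ⟨h.2.1, h.1, ?_⟩
  have : Std.Symm fun u v : EuclideanSpace ℝ (Fin d) => u ∈ A ∧ v ∈ A ∧ v - u ∈ X :=
    ⟨fun a b hab => ⟨hab.2.1, hab.1, by simpa using hX _ hab.2.2⟩⟩
  exact Std.Symm.symm _ _ h.2.2

theorem Joined.step {u v : EuclideanSpace ℝ (Fin d)} (hu : u ∈ A) (hv : v ∈ A)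
    (h : v - u ∈ X) : Joined X A u v :=
  ⟨hu, hv, Relation.ReflTransGen.single ⟨hu, hv, h⟩⟩

theorem joined_of_dist_lt {r : ℝ} (hr : Metric.ball 0 r ⊆ X) {u v : EuclideanSpace ℝ (Fin d)}
    (hu : u ∈ A) (hv : v ∈ A) (h : dist v u < r) : Joined X A u v :=
  Joined.step hu hv (hr (by rwa [mem_ball_zero_iff, ← dist_eq_norm]))

/-- Points of `A` closer than `r` are joined, so a component is relatively open in `A`. -/
theorem nullMeasurableSet_component (hA : NullMeasurableSet A volume) {r : ℝ} (hr0 : 0 < r)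
    (hr : Metric.ball 0 r ⊆ X) (z : EuclideanSpace ℝ (Fin d)) :
    NullMeasurableSet {w | Joined X A z w} volume := by
  have : {w | Joined X A z w} = A ∩ ⋃ w ∈ {w | Joined X A z w}, Metric.ball w r := by
    ext w
    rw [Set.mem_inter_iff, Set.mem_iUnion₂]
    constructor
    · exact fun h => ⟨h.2.1, w, h, Metric.mem_ball_self hr0⟩
    · rintro ⟨hw, v, hv, hwv⟩
      exact Joined.trans hv (joined_of_dist_lt hr hv.2.1 hw hwv)
  rw [this]
  exact hA.inter (isOpen_biUnion fun w _ => Metric.isOpen_ball).measurableSet.nullMeasurableSet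

end Components

/-! ### Phases on components -/

section Phases

variable {f h : EuclideanSpace ℝ (Fin d) → ℂ}

theorem ae_norm_eq_of_autoProd_zero (H : autoProd f 0 =ᵐ[volume] autoProd h 0) :
    ∀ᵐ y, ‖f y‖ = ‖h y‖ := by
  filter_upwards [H] with y hy
  simp only [autoProd, sub_zero, Complex.mul_conj, Complex.normSq_eq_norm_sq] at hy
  exact (sq_eq_sq₀ (norm_nonneg _) (norm_nonneg _)).1 (Complex.ofReal_injective hy)

/-- Fubini and the substitution `y' = y - x` exchange a fixed translation for a fixed base point
`y`, against which nearby values can be compared. -/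
theorem ae_ae_mul_conj_eq_of_stronglyMeasurable (hf : StronglyMeasurable f)
    (hh : StronglyMeasurable h) {r : ℝ}
    (H : ∀ x ∈ Metric.ball 0 r, autoProd f x =ᵐ[volume] autoProd h x) :
    ∀ᵐ y, ∀ᵐ y', dist y y' < r → f y * conj (f y') = h y * conj (h y') := by
  have h1 : ∀ᵐ x : EuclideanSpace ℝ (Fin d), ∀ᵐ y, ‖x‖ < r → autoProd f x y = autoProd h x y := by
    refine Eventually.of_forall fun x => ?_
    by_cases hx : ‖x‖ < r
    · filter_upwards [H x (mem_ball_zero_iff.2 hx)] with y hy _ using hy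
    · exact Eventually.of_forall fun y hy => absurd hy hx
  have hc : Measurable (fun z : ℂ => conj z) := Complex.continuous_conj.measurable
  have m2 : Measurable fun p : EuclideanSpace ℝ (Fin d) × EuclideanSpace ℝ (Fin d) =>
    p.2 - p.1 := by fun_prop
  have hm : ∀ {k : EuclideanSpace ℝ (Fin d) → ℂ}, StronglyMeasurable k →
      Measurable fun p : EuclideanSpace ℝ (Fin d) × EuclideanSpace ℝ (Fin d) =>
        autoProd k p.1 p.2 := fun hk =>
    (hk.measurable.comp measurable_snd).mul (hc.comp (hk.measurable.comp m2))
  have h2 := (Measure.ae_ae_comm (by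
    have e1 : MeasurableSet {p : EuclideanSpace ℝ (Fin d) × EuclideanSpace ℝ (Fin d) |
        ‖p.1‖ < r} := measurableSet_lt (by fun_prop) measurable_const
    have e2 := measurableSet_eq_fun (hm hf) (hm hh)
    exact e1.imp e2)).1 h1
  filter_upwards [h2] with y hy
  filter_upwards [(quasiMeasurePreserving_sub_left volume y).ae hy]
    with y' hy' hdist
  have := hy' (by rwa [← dist_eq_norm])
  simpa [autoProd] using this

theorem ae_ae_mul_conj_eq (hf : AEStronglyMeasurable f volume)
    (hh : AEStronglyMeasurable h volume) {r : ℝ}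
    (H : ∀ x ∈ Metric.ball 0 r, autoProd f x =ᵐ[volume] autoProd h x) :
    ∀ᵐ y, ∀ᵐ y', dist y y' < r → f y * conj (f y') = h y * conj (h y') := by
  have key := ae_ae_mul_conj_eq_of_stronglyMeasurable hf.stronglyMeasurable_mk
    hh.stronglyMeasurable_mk (r := r) fun x hx =>
      (autoProd_congr_ae hf.ae_eq_mk x).symm.trans
        ((H x hx).trans (autoProd_congr_ae hh.ae_eq_mk x))
  filter_upwards [key, hf.ae_eq_mk, hh.ae_eq_mk] with y hy h1 h2
  filter_upwards [hy, hf.ae_eq_mk, hh.ae_eq_mk] with y' hy' h3 h4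
  rwa [h1, h2, h3, h4]

/-- Near a density point of the support, the two signals differ by a constant phase. -/
theorem exists_local_phase (hf : AEStronglyMeasurable f volume)
    (hh : AEStronglyMeasurable h volume) {r : ℝ} (hr : 0 < r)
    (H : ∀ x ∈ Metric.ball 0 r, autoProd f x =ᵐ[volume] autoProd h x)
    {z : EuclideanSpace ℝ (Fin d)} (hz : z ∈ densitySupport f) :
    ∃ γ : ℂ, ‖γ‖ = 1 ∧ ∃ U ∈ 𝓝 z, ∀ᵐ y, y ∈ U → h y = γ * f y := by
  have hnorm := ae_norm_eq_of_autoProd_zero (H 0 (Metric.mem_ball_self hr))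
  have hU : Metric.ball z (r / 2) ∈ 𝓝 z := Metric.ball_mem_nhds z (half_pos hr)
  have hex := not_ae_not_mem_of_mem_densityPoints (nullMeasurableSet_ne_zero hf) hz hU
  rw [not_eventually] at hex
  obtain ⟨y, hy, hyn, hyH⟩ := (hex.and_eventually
    (hnorm.and (ae_ae_mul_conj_eq hf hh H))).exists
  obtain ⟨hyU, hyf⟩ := not_not.1 hy
  have hyf' : f y ≠ 0 := hyf
  have hyh : h y ≠ 0 := by rwa [← norm_ne_zero_iff, ← hyn, norm_ne_zero_iff]
  -- This phase solves the conjugate of `f y * conj (f y') = h y * conj (h y')` for `h y'`. The ball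
  -- has radius `r / 2`, so any two of its points are closer than `r`.
  refine ⟨conj (f y / h y), ?_, _, hU, ?_⟩
  · rw [Complex.norm_conj, norm_div, hyn, div_self (norm_ne_zero_iff.2 hyh)]
  · filter_upwards [hyH] with y' hy' hmem
    have hd : dist y y' < r := by
      have := dist_triangle_right y y' z
      rw [Metric.mem_ball] at hyU hmem
      linarith
    have := congrArg conj (hy' hd)
    simp only [map_mul, Complex.conj_conj] at this
    have hc : conj (h y) ≠ 0 := by simpa using hyh
    rw [map_div₀]
    field_simp
    rw [this, mul_comm]

/-- Local phases agree along admissible translations. -/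
theorem local_phase_eq (hf : AEStronglyMeasurable f volume) {z w : EuclideanSpace ℝ (Fin d)}
    (hz : z ∈ densitySupport f) (hw : w ∈ densitySupport f)
    (H : autoProd f (w - z) =ᵐ[volume] autoProd h (w - z)) {γ γ' : ℂ} (hγ : ‖γ‖ = 1)
    {U V : Set (EuclideanSpace ℝ (Fin d))} (hU : U ∈ 𝓝 z) (hV : V ∈ 𝓝 w)
    (hUγ : ∀ᵐ y, y ∈ U → h y = γ * f y) (hVγ : ∀ᵐ y, y ∈ V → h y = γ' * f y) : γ' = γ := by
  have hc : Continuous fun y : EuclideanSpace ℝ (Fin d) => y - (w - z) := by fun_prop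
  have hU' : (fun y => y - (w - z)) ⁻¹' U ∈ 𝓝 w := hc.continuousAt (by simpa using hU)
  have hex := not_ae_not_mem_inter_translate (nullMeasurableSet_ne_zero hf) hz hw
    (inter_mem hV hU')
  rw [not_eventually] at hex
  obtain ⟨y, hy, hyH, h1, h2⟩ := (hex.and_eventually (H.and (hVγ.and
    ((measurePreserving_sub_right volume (w - z)).quasiMeasurePreserving.ae hUγ)))).exists
  obtain ⟨⟨hyV, hyU⟩, hf1, hf2⟩ := not_not.1 hy
  have hf1' : f y ≠ 0 := hf1
  have hf2' : conj (f (y - (w - z))) ≠ 0 := by simpa using! hf2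
  rw [autoProd, autoProd, h1 hyV, h2 hyU, map_mul] at hyH
  have hprod : γ' * conj γ = 1 := by
    have h0 : f y * conj (f (y - (w - z))) ≠ 0 := mul_ne_zero hf1' hf2'
    refine mul_right_cancel₀ h0 ?_
    rw [one_mul]
    conv_rhs => rw [hyH]
    ring
  have hγγ : conj γ * γ = 1 := by
    rw [mul_comm, Complex.mul_conj, Complex.normSq_eq_norm_sq, hγ]; simp
  calc γ' = γ' * (conj γ * γ) := by rw [hγγ, mul_one]
    _ = γ := by rw [← mul_assoc, hprod, one_mul]

/-- On each connectivity component, two signals with equal products `autoProd` differ by a constant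
phase. -/
theorem exists_phase_on_component {X : Set (EuclideanSpace ℝ (Fin d))}
    (hf : AEStronglyMeasurable f volume)
    (hh : AEStronglyMeasurable h volume) {r : ℝ} (hr : 0 < r) (hrX : Metric.ball 0 r ⊆ X)
    (H : ∀ x ∈ X, autoProd f x =ᵐ[volume] autoProd h x)
    {C : Set (EuclideanSpace ℝ (Fin d))} (hC : C ∈ components X (densitySupport f)) :
    ∃ γ : ℂ, ‖γ‖ = 1 ∧ ∀ᵐ x, x ∈ C → h x = γ * f x := by
  obtain ⟨z, hz, rfl⟩ := hC
  have hloc := fun w hw => exists_local_phase hf hh hr (fun x hx => H x (hrX hx)) (z := w) hw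
  obtain ⟨γ, hγ, hUz⟩ := hloc z hz
  have hall : ∀ w, Joined X (densitySupport f) z w →
      ∃ U ∈ 𝓝 w, ∀ᵐ y, y ∈ U → h y = γ * f y := by
    rintro w ⟨-, -, hw⟩
    induction hw with
    | refl => exact hUz
    | tail _ hvw ih =>
      obtain ⟨U, hU, hUγ⟩ := ih
      obtain ⟨γ', -, V, hV, hVγ⟩ := hloc _ hvw.2.1
      rw [local_phase_eq hf hvw.1 hvw.2.1 (H _ hvw.2.2) hγ hU hV hUγ hVγ] at hVγ
      exact ⟨V, hV, hVγ⟩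
  refine ⟨γ, hγ, ?_⟩
  rw [ae_iff]
  -- Each point has its own exceptional null set; local nullness suffices although there are
  -- uncountably many points.
  refine measure_null_of_locally_null _ fun w hw => ?_
  obtain ⟨hwC, -⟩ := Classical.not_imp.1 hw
  obtain ⟨U, hU, hUγ⟩ := hall w hwC
  refine ⟨U ∩ {a | ¬ (a ∈ {v | Joined X (densitySupport f) z v} → h a = γ * f a)},
    inter_mem (mem_nhdsWithin_of_mem_nhds hU) self_mem_nhdsWithin, ?_⟩
  refine measure_mono_null (fun y hy => ?_) (ae_iff.1 hUγ)
  exact fun hyU => hy.2 fun _ => hyU hy.1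

/-- Signals that differ by a constant phase on each connectivity component have the same products
`autoProd` for all admissible translations. -/
theorem autoProd_ae_eq_of_phases {X : Set (EuclideanSpace ℝ (Fin d))}
    (hf : AEStronglyMeasurable f volume)
    (hh : AEStronglyMeasurable h volume) {r : ℝ} (hr : 0 < r) (hrX : Metric.ball 0 r ⊆ X)
    (hX : ∀ x ∈ X, -x ∈ X) (hsupp : densitySupport h = densitySupport f)
    (H : ∀ C ∈ components X (densitySupport f),
      ∃ γ : ℂ, ‖γ‖ = 1 ∧ ∀ᵐ x, x ∈ C → h x = γ * f x)
    {x : EuclideanSpace ℝ (Fin d)} (hx : x ∈ X) : autoProd f x =ᵐ[volume] autoProd h x := by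
  have hzero := ae_eq_zero_iff_of_densitySupport_eq hf hh hsupp
  have hA := ae_mem_densitySupport_iff hf
  have mp := (measurePreserving_sub_right (volume : Measure (EuclideanSpace ℝ (Fin d)))
    x).quasiMeasurePreserving
  have hmain : ∀ᵐ y, y ∈ densitySupport f ∧ y - x ∈ densitySupport f →
      autoProd f x y = autoProd h x y := by
    rw [ae_iff]
    refine measure_null_of_locally_null _ fun w hw => ?_
    obtain ⟨⟨hw1, -⟩, -⟩ := Classical.not_imp.1 hw
    obtain ⟨γ, hγ, hC⟩ := H _ ⟨w, hw1, rfl⟩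
    have hC' := mp.ae hC
    refine ⟨Metric.ball w r ∩ {a | ¬ (a ∈ densitySupport f ∧ a - x ∈ densitySupport f →
        autoProd f x a = autoProd h x a)},
      inter_mem (mem_nhdsWithin_of_mem_nhds (Metric.ball_mem_nhds w hr)) self_mem_nhdsWithin, ?_⟩
    refine measure_mono_null (fun y hy => ?_) (ae_iff.1 (hC.and hC'))
    refine fun hgood => hy.2 fun hyA => ?_
    -- Both `y` and `y - x` lie in the component of `w`, so a single phase multiplies both factors
    -- and cancels.
    have j1 : Joined X (densitySupport f) w y := joined_of_dist_lt hrX hw1 hyA.1 hy.1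
    have j2 : Joined X (densitySupport f) w (y - x) :=
      j1.trans (Joined.step hyA.1 hyA.2 (by simpa using hX x hx))
    rw [autoProd, autoProd, hgood.1 j1, hgood.2 j2, map_mul, mul_mul_mul_comm, Complex.mul_conj γ,
      Complex.normSq_eq_norm_sq, hγ]
    simp
  filter_upwards [hmain, hzero, hA, mp.ae hzero, mp.ae hA] with y h1 h2 h3 h4 h5
  by_cases e1 : f y = 0
  · simp [autoProd, e1, h2.2 e1]
  by_cases e2 : f (y - x) = 0
  · simp [autoProd, e2, h4.2 e2]
  exact h1 ⟨h3.2 e1, h5.2 e2⟩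

theorem densitySupport_eq_of_autoProd_zero (H : autoProd f 0 =ᵐ[volume] autoProd h 0) :
    densitySupport h = densitySupport f :=
  densitySupport_congr (by
    filter_upwards [ae_norm_eq_of_autoProd_zero H] with y hy
    rw [← norm_eq_zero, ← hy, norm_eq_zero])

end Phases

/-! ### The characterization and phase retrievability -/

/-- Characterization of all signals with the same phaseless measurements. -/
theorem sameMeasurement_iff_phases {g f h : EuclideanSpace ℝ (Fin d) → ℂ}
    (hg : ExpDecay g ∨ OneSided g) (hg_ne : ¬ ∀ᵐ x, g x = 0)
    (hf : MemLp f 2 volume) (hh : MemLp h 2 volume) :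
    SameMeasurement g f h ↔ densitySupport h = densitySupport f ∧
      ∀ C ∈ components (admissible g) (densitySupport f),
        ∃ γ : ℂ, ‖γ‖ = 1 ∧ ∀ᵐ x, x ∈ C → h x = γ * f x := by
  have hg2 : MemLp g 2 volume := hg.elim (fun h => h.1) (fun h => h.1)
  have h0 := zero_mem_admissible hg_ne
  obtain ⟨r, hr, hrX⟩ := Metric.isOpen_iff.1 (isOpen_admissible hg2) 0 h0
  constructor
  · intro H
    have H' := fun x hx => SameMeasurement.autoProd_ae_eq hg hf hh H (x := x) hx
    exact ⟨densitySupport_eq_of_autoProd_zero (H' 0 h0),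
      fun C hC => exists_phase_on_component hf.1 hh.1 hr hrX H' hC⟩
  · rintro ⟨hs, H⟩
    exact sameMeasurement_of_autoProd hg2 hf hh fun x hx =>
      autoProd_ae_eq_of_phases hf.1 hh.1 hr hrX (fun _ => neg_mem_admissible) hs H hx

theorem phaseRetrievable_of_signalConnected {g f : EuclideanSpace ℝ (Fin d) → ℂ}
    (hg : ExpDecay g ∨ OneSided g) (hg_ne : ¬ ∀ᵐ x, g x = 0) (hf : MemLp f 2 volume)
    (hconn : SignalConnected (admissible g) f) : PhaseRetrievable g f := by
  intro h hh H
  obtain ⟨hs, hph⟩ := (sameMeasurement_iff_phases hg hg_ne hf hh).1 H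
  have hzero := ae_eq_zero_iff_of_densitySupport_eq hf.1 hh.1 hs
  have hA := ae_mem_densitySupport_iff hf.1
  rcases (densitySupport f).eq_empty_or_nonempty with he | ⟨z, hz⟩
  · refine ⟨1, norm_one, ?_⟩
    filter_upwards [hzero, hA] with y h1 h2
    have : f y = 0 := by
      by_contra hne
      have := h2.2 hne
      rw [he] at this
      exact this
    rw [this, h1.2 this, mul_zero]
  · obtain ⟨γ, hγ, hC⟩ := hph _ ⟨z, hz, rfl⟩
    refine ⟨γ, hγ, ?_⟩
    filter_upwards [hzero, hA, hC] with y h1 h2 h3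
    by_cases hy : f y = 0
    · rw [hy, h1.2 hy, mul_zero]
    · have hyA := h2.2 hy
      have hmem : y ∈ {w | Joined (admissible g) (densitySupport f) z w} := by
        rw [hconn ⟨z, hz, rfl⟩ ⟨y, hyA, rfl⟩]
        exact Joined.refl hyA
      exact h3 hmem

theorem signalConnected_of_phaseRetrievable {g f : EuclideanSpace ℝ (Fin d) → ℂ}
    (hg : ExpDecay g ∨ OneSided g) (hg_ne : ¬ ∀ᵐ x, g x = 0) (hf : MemLp f 2 volume)
    (hret : PhaseRetrievable g f) : SignalConnected (admissible g) f := by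
  classical
  have hg2 : MemLp g 2 volume := hg.elim (fun h => h.1) (fun h => h.1)
  obtain ⟨r, hr, hrX⟩ := Metric.isOpen_iff.1 (isOpen_admissible hg2) 0 (zero_mem_admissible hg_ne)
  set X := admissible g with hXdef
  have hX : ∀ x ∈ X, -x ∈ X := fun _ => neg_mem_admissible
  have hSm := nullMeasurableSet_ne_zero hf.1
  have hA := ae_mem_densitySupport_iff hf.1
  have hAm : NullMeasurableSet (densitySupport f) volume :=
    hSm.congr (by filter_upwards [hA] with y hy using (propext hy).symm)
  have hjoin : ∀ z ∈ densitySupport f, ∀ w ∈ densitySupport f, Joined X (densitySupport f) z w := by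
    intro z hz w hw
    by_contra hzw
    set C := {v | Joined X (densitySupport f) z v} with hC
    have hCm : NullMeasurableSet C volume := nullMeasurableSet_component hAm hr hrX z
    -- Changing the sign off the component of `z` leaves the measurements unchanged, because every
    -- component lies inside `C` or outside it.
    set h : EuclideanSpace ℝ (Fin d) → ℂ := fun y => if y ∈ C then f y else -f y with hh
    have hnorm : ∀ y, ‖h y‖ = ‖f y‖ := fun y => by
      by_cases hy : y ∈ C <;> simp [hh, hy]
    have hmeas : AEStronglyMeasurable h volume := by
      obtain ⟨D, hD, hCD⟩ := hCm
      refine (AEStronglyMeasurable.piecewise hD hf.1.restrict hf.1.neg.restrict).congr ?_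
      filter_upwards [hCD.mem_iff] with y hy
      simp only [hh, Set.piecewise, hy, Pi.neg_apply]
    have hh2 : MemLp h 2 volume :=
      hf.congr_norm hmeas (Eventually.of_forall fun y => (hnorm y).symm)
    have hsame : SameMeasurement g f h := by
      refine (sameMeasurement_iff_phases hg hg_ne hf hh2).2
        ⟨densitySupport_congr (Eventually.of_forall fun y => ?_), ?_⟩
      · rw [← norm_eq_zero, hnorm, norm_eq_zero]
      · rintro _ ⟨v, hv, rfl⟩
        by_cases hvC : v ∈ C
        · refine ⟨1, norm_one, Eventually.of_forall fun y hy => ?_⟩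
          have : y ∈ C := Joined.trans hvC hy
          simp [hh, this]
        · refine ⟨-1, by simp, Eventually.of_forall fun y hy => ?_⟩
          have : y ∉ C := fun hyC => hvC (Joined.trans hyC (Joined.symm hX hy))
          simp [hh, this]
    obtain ⟨γ, -, hγ⟩ := hret h hh2 hsame
    -- Every component contains a ball's worth of density points, hence a set of positive measure
    -- where `f ≠ 0`; so a global phase would equal `1` on one component and `-1` on another.
    have hpick : ∀ v ∈ densitySupport f, ∃ y, Joined X (densitySupport f) v y ∧ f y ≠ 0 ∧
        h y = γ * f y := by
      intro v hv
      have hex := not_ae_not_mem_of_mem_densityPoints hSm hv (Metric.ball_mem_nhds v hr)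
      rw [not_eventually] at hex
      obtain ⟨y, hy, hyA, hyγ⟩ := (hex.and_eventually (hA.and hγ)).exists
      obtain ⟨hyv, hyf⟩ := not_not.1 hy
      exact ⟨y, joined_of_dist_lt hrX hv (hyA.2 hyf) hyv, hyf, hyγ⟩
    obtain ⟨y, hzy, hy0, hy⟩ := hpick z hz
    obtain ⟨y', hwy, hy0', hy'⟩ := hpick w hw
    have e1 : y ∈ C := hzy
    have e2 : y' ∉ C := fun hyC => hzw (Joined.trans hyC (Joined.symm hX hwy))
    have g1 : γ = 1 := by
      simp only [hh, e1, if_true] at hy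
      exact mul_right_cancel₀ hy0 (by rw [one_mul]; exact hy.symm)
    have g2 : γ = -1 := by
      simp only [hh, e2, if_false] at hy'
      exact mul_right_cancel₀ hy0' (by rw [neg_one_mul]; exact hy'.symm)
    rw [g1] at g2
    norm_num at g2
  rintro _ ⟨z, hz, rfl⟩ _ ⟨w, hw, rfl⟩
  ext v
  exact ⟨fun hv => Joined.trans (hjoin w hw z hz) hv, fun hv => Joined.trans (hjoin z hz w hw) hv⟩

end STFTPhase

theorem theorem4 (d : ℕ) (g f : EuclideanSpace ℝ (Fin d) → ℂ)
    (hg : STFTPhase.ExpDecay g ∨ STFTPhase.OneSided g)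
    (hg_ne : ¬ ∀ᵐ x, g x = 0)
    (hf : MemLp f 2 volume) :
    (∀ h : EuclideanSpace ℝ (Fin d) → ℂ, MemLp h 2 volume →
      (STFTPhase.SameMeasurement g f h ↔
        STFTPhase.densitySupport h = STFTPhase.densitySupport f ∧
        ∀ C ∈ STFTPhase.components (STFTPhase.admissible g) (STFTPhase.densitySupport f),
          ∃ γ : ℂ, ‖γ‖ = 1 ∧ ∀ᵐ x, x ∈ C → h x = γ * f x)) ∧
    (STFTPhase.PhaseRetrievable g f ↔
      STFTPhase.SignalConnected (STFTPhase.admissible g) f) :=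
  ⟨fun _ hh => STFTPhase.sameMeasurement_iff_phases hg hg_ne hf hh,
    STFTPhase.signalConnected_of_phaseRetrievable hg hg_ne hf,
    STFTPhase.phaseRetrievable_of_signalConnected hg hg_ne hf⟩
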